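/- Let $\omega_1$ denote the set of countable ordinals. The \emph{stationary set splitting game} $\mathcal{SG}$ is the following game of perfect information of length $\omega_1$ between two players, Unsplitter and Splitter. In each round $\alpha<\omega_1$, Unsplitter either accepts or rejects $\alpha$; if Unsplitter accepts $\alpha$, then Splitter puts $\alpha$ into one of two sets $A$ and $B$, and if Unsplitter rejects $\alpha$, then Splitter does nothing. After all $\omega_1$ rounds, Splitter wins if the set $E$ of accepted ordinals is not stationary in $\omega_1$, or if both $A$ and $B$ are stationary in $\omega_1$. Let $H(\aleph_2)$ be the set of all sets whose transitive closure has cardinality less than $\aleph_2$. A set $\mathcal{X}$ of countable subsets of $H(\aleph_2)$ is \emph{stationary} if for every function $F\colon [H(\aleph_2)]^{<\omega}\to H(\aleph_2)$ there is an element of $\mathcal{X}$ closed under $F$, and \emph{projective stationary} if for every stationary $S\subseteq\omega_1$ the set $\{X\in\mathcal{X} : X\cap\omega_1\in S\}$ is stationary. Let $\mathcal{C}+$ be the statement that there exists a projective stationary set $\mathcal{X}$ consisting of countable elementary substructures of $(H(\aleph_2),\in)$ such that for all $X,Y\in\mathcal{X}$ with $X\cap\omega_1=Y\cap\omega_1$,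 at least one of the following holds: \begin{itemize} \item for every club $C\subseteq\omega_1$ with $C\in X$ there is a club $D\subseteq\omega_1$ with $D\in Y$ and $D\cap X\subseteq C\cap X$; \item for every club $D\subseteq\omega_1$ with $D\in Y$ there is a club $C\subseteq\omega_1$ with $C\in X$ and $C\cap X\subseteq D\cap X$. \end{itemize} \textbf{Theorem.} If $\mathcal{C}+$ holds, then Splitter has a winning strategy in $\mathcal{SG}$. -/

import Mathlib

open scoped Ordinal Cardinal

universe u

namespace SplittingGame

/-- The set `ω₁` of countable ordinals, as a linearly ordered type. -/
abbrev Omega1 : Type (u + 1) := Set.Iio (ω₁ : Ordinal.{u})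

/-! ### The stationary set splitting game -/

/-- The outcome of a round `α` of the game: Unsplitter rejects `α`, or Unsplitter accepts `α` and
Splitter puts it into `A` or into `B`. -/
inductive Outcome : Type
  | rejected
  | inA
  | inB

/-- The two possible moves of Splitter in a round in which Unsplitter accepts. -/
inductive Side : Type
  | A
  | B

/-- The outcome of a round in which Unsplitter accepts and Splitter answers with the given side. -/
def Side.outcome : Side → Outcome
  | .A => .inA
  | .B => .inB

/-- A complete run of the game: one outcome for each of the `ω₁` rounds. -/
abbrev Run : Type (u + 1) := Omega1.{u} → Outcome

/-- A partial run of length `α`: the outcomes of all rounds before round `α`. -/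
abbrev PartialRun (α : Omega1.{u}) : Type (u + 1) := Set.Iio α → Outcome

/-- The restriction of a run to the rounds before `α`. -/
def Run.before (r : Run.{u}) (α : Omega1.{u}) : PartialRun α := fun β => r β.1

/-- The set `E` of ordinals accepted by Unsplitter. -/
def Run.E (r : Run.{u}) : Set Omega1.{u} := {α | r α ≠ .rejected}

/-- The set of ordinals put into `A` by Splitter. -/
def Run.A (r : Run.{u}) : Set Omega1.{u} := {α | r α = .inA}

/-- The set of ordinals put into `B` by Splitter. -/
def Run.B (r : Run.{u}) : Set Omega1.{u} := {α | r α = .inB}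

/-- Splitter wins a run if Unsplitter has not accepted stationarily often, or if `A` and `B` are
both stationary. -/
def Run.SplitterWins (r : Run.{u}) : Prop :=
  ¬ IsStationary r.E ∨ (IsStationary r.A ∧ IsStationary r.B)

/-- A strategy for Splitter: for each round `α` and each partial run of length `α`, the answer to be
given in round `α` in case Unsplitter accepts `α`. -/
abbrev SplitterStrategy : Type (u + 1) := (α : Omega1.{u}) → PartialRun α → Side

/-- In the run `r`, Splitter has played by the strategy `σ`. -/
def Run.Follows (r : Run.{u}) (σ : SplitterStrategy.{u}) : Prop :=
  ∀ α ∈ r.E, r α = (σ α (r.before α)).outcome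

/-- Splitter has a winning strategy in the stationary set splitting game. -/
def SplitterHasWinningStrategy : Prop :=
  ∃ σ : SplitterStrategy.{u}, ∀ r : Run.{u}, r.Follows σ → r.SplitterWins

/-! ### Countable elementary substructures of `H(ℵ₂)` -/

/-- `H(ℵ₂)`: the sets whose transitive closure has cardinality less than `ℵ₂`. -/
def HAleph2 : Type (u + 1) :=
  {x : ZFSet.{u} // #{y : ZFSet.{u} // Relation.TransGen (· ∈ ·) y x} < ℵ_ 2}

/-- The only symbol of the language of set theory, the binary relation symbol for membership. -/
inductive SetRel : ℕ → Type
  | mem : SetRel 2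

/-- The first-order language of set theory. -/
def setLanguage : FirstOrder.Language := ⟨fun _ => Empty, SetRel⟩

/-- `H(ℵ₂)` as a structure for the language of set theory, with the true membership relation. -/
instance : setLanguage.Structure HAleph2.{u} where
  funMap f := nomatch f
  RelMap | .mem => fun v => (v 0).1 ∈ (v 1).1

/-- `X` is (the universe of) an elementary substructure of `H(ℵ₂)`. -/
def IsElementary (X : Set HAleph2.{u}) : Prop :=
  ∃ N : setLanguage.ElementarySubstructure HAleph2.{u}, (N : Set HAleph2.{u}) = X

/-- The set `X ∩ ω₁`. -/
def omega1Part (X : Set HAleph2.{u}) : Set Omega1.{u} :=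
  {α | ∃ x ∈ X, x.1 = α.1.toZFSet}

/-- A collection `𝒳` of subsets of `M` is stationary if for every function `F` from the finite
subsets of `M` to `M` there is an element of `𝒳` closed under `F`. -/
def IsStationaryFamily {M : Type*} (𝒳 : Set (Set M)) : Prop :=
  ∀ F : Finset M → M, ∃ X ∈ 𝒳, ∀ s : Finset M, (s : Set M) ⊆ X → F s ∈ X

/-- `𝒳` is projective stationary: for every stationary `S ⊆ ω₁` the set of `X ∈ 𝒳` such that
`X ∩ ω₁` is (an ordinal) in `S` is stationary. An ordinal `δ < ω₁` is the set `Set.Iio δ` of its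
predecessors. -/
def IsProjectiveStationary (𝒳 : Set (Set HAleph2.{u})) : Prop :=
  ∀ S : Set Omega1.{u}, IsStationary S →
    IsStationaryFamily {X ∈ 𝒳 | ∃ δ ∈ S, omega1Part X = Set.Iio δ}

/-- The elements of a set `C ∈ H(ℵ₂)`; all of them are in `H(ℵ₂)`. -/
def elements (C : HAleph2.{u}) : Set HAleph2.{u} := {z | z.1 ∈ C.1}

/-- The element `C` of `H(ℵ₂)` is a club subset of `ω₁`. -/
def IsClubElement (C : HAleph2.{u}) : Prop :=
  C.1 ⊆ (ω₁ : Ordinal.{u}).toZFSet ∧ IsClub {α : Omega1.{u} | α.1.toZFSet ∈ C.1}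

/-- The principle `𝒞+`. -/
def CPlus : Prop :=
  ∃ 𝒳 : Set (Set HAleph2.{u}),
    IsProjectiveStationary 𝒳 ∧
    (∀ X ∈ 𝒳, X.Countable ∧ IsElementary X) ∧
    ∀ X ∈ 𝒳, ∀ Y ∈ 𝒳, omega1Part X = omega1Part Y →
      (∀ C ∈ X, IsClubElement C →
        ∃ D ∈ Y, IsClubElement D ∧ elements D ∩ X ⊆ elements C ∩ X) ∨
      (∀ D ∈ Y, IsClubElement D →
        ∃ C ∈ X, IsClubElement C ∧ elements C ∩ X ⊆ elements D ∩ X)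

end SplittingGame

/-!
Splitter's strategy is to decide round `δ` by looking for evidence among the sets `X ∈ 𝒳` with
`X ∩ ω₁ = δ`. Such an `X` is evidence that a side has been avoided if some club in `X` contains no
earlier round put into that side, while every club in `X` contains an earlier accepted round
(`IsEvidence`). Splitter puts `δ` into `A` if there is evidence that `A` has been avoided, and into
`B` otherwise.

There is never evidence at the same `δ` that both sides have been avoided
(`IsEvidence.not_of_refines`). By `𝒞+`, the clubs of one of the two sets refine, below `δ`, the
clubs of the other. Hence one of the sets contains both a club avoiding `A` below `δ` and a club
avoiding `B` below `δ`; their intersection contains no accepted round below `δ`, a contradiction.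

Suppose now that Unsplitter accepts stationarily often and that a club `K` avoids one of the sides.
Projective stationarity provides an `X ∈ 𝒳`, closed under suitable operations, such that
`δ = X ∩ ω₁` is accepted, belongs to `K`, and `X` is evidence that the side has been avoided
(`exists_isEvidence`). The strategy then puts `δ` into that very side, which contradicts `δ ∈ K`.

The closure properties of `X` used here, among them closure under intersections of clubs, are
imposed directly through the function `F` in the definition of stationarity
(`IsStationaryFamily.exists_closed`).
-/

namespace SplittingGame

open Set

theorem cof_omega1_ne_aleph0 : Order.cof Omega1.{u} ≠ ℵ₀ := by
  rw [Ordinal.cof_Iio, Ordinal.lift_omega, Ordinal.lift_one, Cardinal.cof_omega_one]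
  exact Cardinal.aleph0_lt_aleph_one.ne'

theorem noMaxOrder_omega1 : NoMaxOrder Omega1.{u} :=
  ⟨fun α => ⟨⟨Order.succ α.1, (Cardinal.isSuccLimit_omega 1).succ_lt α.2⟩, Order.lt_succ α.1⟩⟩

/-- Subsets of `ω₁` belong to `H(ℵ₂)`: their transitive closure is a subset of `ω₁`. -/
theorem mk_transClosure_lt_aleph_two {x : ZFSet.{u}} (hx : x ⊆ (ω₁ : Ordinal.{u}).toZFSet) :
    #{y : ZFSet.{u} // Relation.TransGen (· ∈ ·) y x} < ℵ_ 2 := by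
  have hsub : {y : ZFSet.{u} | Relation.TransGen (· ∈ ·) y x} ⊆
      Ordinal.toZFSet '' Iio (ω₁ : Ordinal.{u}) := by
    intro y hy
    simp only [mem_ofPred_eq] at hy
    induction hy using Relation.TransGen.head_induction_on with
    | single h =>
      obtain ⟨a, ha, rfl⟩ := Ordinal.mem_toZFSet_iff.1 (hx h)
      exact ⟨a, ha, rfl⟩
    | head h _ ih =>
      obtain ⟨a, ha, rfl⟩ := ih
      obtain ⟨b, hb, rfl⟩ := Ordinal.mem_toZFSet_iff.1 h
      exact ⟨b, hb.trans ha, rfl⟩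
  refine (Cardinal.mk_le_mk_of_subset hsub).trans_lt (Cardinal.mk_image_le.trans_lt ?_)
  rw [Cardinal.mk_Iio_ordinal]
  simp

/-- The set of countable ordinals that are elements of `C`. -/
def trace (C : HAleph2.{u}) : Set Omega1.{u} := {α | α.1.toZFSet ∈ C.1}

/-- The countable ordinal `α` as an element of `H(ℵ₂)`. -/
noncomputable def ordinalElement (α : Omega1.{u}) : HAleph2.{u} :=
  ⟨α.1.toZFSet, mk_transClosure_lt_aleph_two (Ordinal.toZFSet_monotone (le_of_lt α.2))⟩

theorem ordinalElement_injective : Function.Injective ordinalElement.{u} := fun _ _ h =>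
  Subtype.ext (Ordinal.toZFSet_injective (congrArg Subtype.val h))

theorem mem_omega1Part {X : Set HAleph2.{u}} {α : Omega1.{u}} :
    α ∈ omega1Part X ↔ ordinalElement α ∈ X :=
  ⟨fun ⟨_, hx, h⟩ => (Subtype.ext h : _ = ordinalElement α) ▸ hx, fun h => ⟨_, h, rfl⟩⟩

/-- Every club of `ω₁` is represented by an element of `H(ℵ₂)`. -/
theorem exists_isClubElement {S : Set Omega1.{u}} (hS : IsClub S) :
    ∃ C : HAleph2.{u}, IsClubElement C ∧ trace C = S := by
  let x : ZFSet.{u} := (ω₁ : Ordinal.{u}).toZFSet.sep fun y => ∃ α ∈ S, α.1.toZFSet = y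
  have hx : x ⊆ (ω₁ : Ordinal.{u}).toZFSet := fun y hy => (ZFSet.mem_sep.1 hy).1
  have htr : {α : Omega1.{u} | α.1.toZFSet ∈ x} = S := by
    ext α
    simp only [x, ZFSet.mem_sep, mem_ofPred_eq, Ordinal.toZFSet_mem_toZFSet_iff,
      Ordinal.toZFSet_injective.eq_iff, ← Subtype.ext_iff, exists_eq_right]
    exact and_iff_right α.2
  exact ⟨⟨x, mk_transClosure_lt_aleph_two hx⟩, ⟨hx, htr.symm ▸ hS⟩, htr⟩

theorem not_isClubElement_ordinalElement (α : Omega1.{u}) :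
    ¬ IsClubElement (ordinalElement α) := by
  intro h
  obtain ⟨β, hβ, hαβ⟩ := h.2.isCofinal α
  exact hαβ.not_gt (Ordinal.toZFSet_mem_toZFSet_iff.1 hβ)

theorem trace_inter_Iio_subset {X : Set HAleph2.{u}} {δ : Omega1.{u}}
    (hX : omega1Part X = Iio δ) {C D : HAleph2.{u}}
    (h : elements D ∩ X ⊆ elements C ∩ X) : trace D ∩ Iio δ ⊆ trace C := by
  rintro α ⟨hαD, hα⟩
  rw [← hX, mem_omega1Part] at hα
  exact (h (show ordinalElement α ∈ elements D ∩ X from ⟨hαD, hα⟩)).1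

/-- A stationary family has a member closed under any prescribed choice of values: any partial
multivalued operation on finite sets can be replaced by a choice function. -/
theorem IsStationaryFamily.exists_closed {M : Type*} {𝒳 : Set (Set M)}
    (h𝒳 : IsStationaryFamily 𝒳) (x₀ : M) (P : Finset M → M → Prop) :
    ∃ X ∈ 𝒳, ∀ s : Finset M, (s : Set M) ⊆ X → (∃ y, P s y) → ∃ y ∈ X, P s y := by
  classical
  obtain ⟨X, hX, hcl⟩ := h𝒳 fun s => if h : ∃ y, P s y then h.choose else x₀
  refine ⟨X, hX, fun s hs h => ⟨_, hcl s hs, ?_⟩⟩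
  rw [dif_pos h]
  exact h.choose_spec

/-- The set `X` is evidence that the outcome `o` has been avoided in the partial run `p`, although
Unsplitter has accepted stationarily often: some club in `X` contains no round with outcome `o`,
whereas every club in `X` contains a round accepted by Unsplitter. The clubs in `X` are required to
be closed under intersection. -/
structure IsEvidence {δ : Omega1.{u}} (p : PartialRun δ) (o : Outcome)
    (X : Set HAleph2.{u}) : Prop where
  exists_avoiding : ∃ C ∈ X, IsClubElement C ∧ ∀ β : Iio δ, β.1 ∈ trace C → p β ≠ o
  exists_accepted : ∀ C ∈ X, IsClubElement C → ∃ β : Iio δ, β.1 ∈ trace C ∧ p β ≠ .rejected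
  exists_inter : ∀ C ∈ X, IsClubElement C → ∀ D ∈ X, IsClubElement D →
    ∃ G ∈ X, IsClubElement G ∧ trace G = trace C ∩ trace D

/-- If the clubs of `Y` refine those of `X` below `δ`, then `X` and `Y` cannot be evidence for two
outcomes that exhaust the accepting ones: the intersection of a club of `Y` avoiding `o'` with one
refining a club that avoids `o` would contain no accepted round. -/
theorem IsEvidence.not_of_refines {δ : Omega1.{u}} {p : PartialRun δ} {o o' : Outcome}
    {X Y : Set HAleph2.{u}} (hX : IsEvidence p o X) (hY : IsEvidence p o' Y)
    (ho : ∀ q : Outcome, q = o ∨ q = o' ∨ q = .rejected)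
    (h : ∀ C ∈ X, IsClubElement C → ∃ D ∈ Y, IsClubElement D ∧ trace D ∩ Iio δ ⊆ trace C) :
    False := by
  obtain ⟨C, hCX, hC, hCo⟩ := hX.exists_avoiding
  obtain ⟨C', hCY, hC', hsub⟩ := h C hCX hC
  obtain ⟨D, hDY, hD, hDo⟩ := hY.exists_avoiding
  obtain ⟨G, hGY, hG, hGeq⟩ := hY.exists_inter C' hCY hC' D hDY hD
  obtain ⟨β, hβ, hacc⟩ := hY.exists_accepted G hGY hG
  rw [hGeq] at hβ
  rcases ho (p β) with h | h | h
  · exact hCo β (hsub ⟨hβ.1, β.2⟩) h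
  · exact hDo β hβ.2 h
  · exact hacc h

/-- If Unsplitter accepts stationarily often, but the outcome `o` does not occur on a club `K`, then
a set `X ∈ 𝒳` sees this: `X` is evidence for it at the round `δ = X ∩ ω₁`, which is accepted and
belongs to `K`. -/
theorem exists_isEvidence {𝒳 : Set (Set HAleph2.{u})} (h𝒳 : IsProjectiveStationary 𝒳)
    {r : Run.{u}} (hE : IsStationary r.E) {o : Outcome} {K : Set Omega1.{u}} (hK : IsClub K)
    (hKo : ∀ α ∈ K, r α ≠ o) :
    ∃ δ ∈ r.E ∩ K, ∃ X ∈ 𝒳, omega1Part X = Iio δ ∧ IsEvidence (r.before δ) o X := by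
  classical
  obtain ⟨C₀, hC₀, hC₀K⟩ := exists_isClubElement hK
  -- Closure under `P` gives `X` the club `C₀`, an element of `K` above each of its ordinals, an
  -- accepted round in each of its clubs, and the intersection of any two of its clubs. The cases
  -- are mutually exclusive, as no ordinal is a club.
  let P : Finset HAleph2.{u} → HAleph2.{u} → Prop := fun s y =>
    (s = ∅ ∧ y = C₀) ∨
    (∃ α β, s = {ordinalElement α} ∧ y = ordinalElement β ∧ β ∈ K ∧ α < β) ∨
    (∃ C β, IsClubElement C ∧ s = {C} ∧ y = ordinalElement β ∧ β ∈ trace C ∧ r β ≠ .rejected) ∨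
    (∃ C D, IsClubElement C ∧ IsClubElement D ∧ C ≠ D ∧ s = {C, D} ∧ IsClubElement y ∧
      trace y = trace C ∩ trace D)
  obtain ⟨X, ⟨hX𝒳, δ, hδE, hδ⟩, hcl⟩ := (h𝒳 r.E hE).exists_closed C₀ P
  have hlt : ∀ {β}, ordinalElement β ∈ X ↔ β < δ := fun {β} => by
    rw [← mem_omega1Part, hδ, mem_Iio]
  have hC₀X : C₀ ∈ X := by
    obtain ⟨y, hy, hP⟩ := hcl ∅ (by simp) ⟨C₀, .inl ⟨rfl, rfl⟩⟩
    have : y = C₀ := by simpa [P, eq_comm (a := (∅ : Finset _))] using hP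
    exact this ▸ hy
  have hnext : ∀ α < δ, ∃ β ∈ K, α < β ∧ β < δ := by
    intro α hα
    have := noMaxOrder_omega1.{u}
    obtain ⟨α', hα'⟩ := exists_gt α
    obtain ⟨β, hβK, hβ⟩ := hK.isCofinal α'
    obtain ⟨y, hy, hP⟩ := hcl {ordinalElement α} (by simpa using hlt.2 hα)
      ⟨ordinalElement β, .inr (.inl ⟨α, β, rfl, rfl, hβK, hα'.trans_le hβ⟩)⟩
    rcases hP with ⟨h, -⟩ | ⟨α₁, β₁, h, rfl, hK₁, h₁⟩ | ⟨C, -, hC, h, -⟩ | ⟨C, D, -, -, hne, h, -⟩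
    · simp at h
    · rw [Finset.singleton_inj, ordinalElement_injective.eq_iff] at h
      exact ⟨β₁, hK₁, h ▸ h₁, hlt.1 hy⟩
    · rw [Finset.singleton_inj] at h
      exact absurd (h ▸ hC) (not_isClubElement_ordinalElement α)
    · have := congrArg Finset.card h
      simp [Finset.card_pair hne] at this
  have hacc : ∀ C ∈ X, IsClubElement C → ∃ β < δ, β ∈ trace C ∧ r β ≠ .rejected := by
    intro C hCX hC
    obtain ⟨β, hβE, hβC⟩ := hE hC.2
    obtain ⟨y, hy, hP⟩ := hcl {C} (by simpa using hCX)
      ⟨ordinalElement β, .inr (.inr (.inl ⟨C, β, hC, rfl, rfl, hβC, hβE⟩))⟩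
    rcases hP with ⟨h, -⟩ | ⟨α₁, β₁, h, -⟩ | ⟨C', β', -, h, rfl, hβ'⟩ | ⟨C, D, -, -, hne, h, -⟩
    · simp at h
    · rw [Finset.singleton_inj] at h
      exact absurd (h ▸ hC) (not_isClubElement_ordinalElement α₁)
    · rw [Finset.singleton_inj] at h
      exact ⟨β', hlt.1 hy, h ▸ hβ'⟩
    · have := congrArg Finset.card h
      simp [Finset.card_pair hne] at this
  have hinter : ∀ C ∈ X, IsClubElement C → ∀ D ∈ X, IsClubElement D →
      ∃ G ∈ X, IsClubElement G ∧ trace G = trace C ∩ trace D := by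
    intro C hCX hC D hDX hD
    rcases eq_or_ne C D with rfl | hne
    · exact ⟨C, hCX, hC, (inter_self _).symm⟩
    obtain ⟨G, hG, hGeq⟩ := exists_isClubElement (hC.2.inter cof_omega1_ne_aleph0 hD.2)
    obtain ⟨y, hy, hP⟩ := hcl {C, D} (by simp [insert_subset_iff, hCX, hDX])
      ⟨G, .inr (.inr (.inr ⟨C, D, hC, hD, hne, rfl, hG, hGeq⟩))⟩
    rcases hP with ⟨h, -⟩ | ⟨α₁, β₁, h, -⟩ | ⟨C', -, -, h, -⟩ | ⟨C', D', -, -, hne', h, hy', htr⟩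
    · simp at h
    · have := congrArg Finset.card h
      simp [Finset.card_pair hne] at this
    · have := congrArg Finset.card h
      simp [Finset.card_pair hne] at this
    · refine ⟨y, hy, hy', htr.trans ?_⟩
      have h' := congrArg (fun s : Finset HAleph2.{u} => (s : Set HAleph2.{u})) h
      simp only [Finset.coe_pair] at h'
      rcases Set.pair_eq_pair_iff.1 h' with ⟨rfl, rfl⟩ | ⟨rfl, rfl⟩
      · rfl
      · exact inter_comm _ _
  -- `δ` is the supremum of `K ∩ δ`.
  have hδK : δ ∈ K := by
    refine hK.isLUB_mem (t := K ∩ Iio δ) inter_subset_left ?_ ⟨fun β hβ => hβ.2.le, ?_⟩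
    · obtain ⟨β, hβ, -⟩ := hacc C₀ hC₀X hC₀
      obtain ⟨β', hβ'K, -, hβ'⟩ := hnext β hβ
      exact ⟨β', hβ'K, hβ'⟩
    · intro γ hγ
      by_contra! hlt'
      obtain ⟨β, hβK, hγβ, hβ⟩ := hnext γ hlt'
      exact hγβ.not_ge (hγ ⟨hβK, hβ⟩)
  refine ⟨δ, ⟨hδE, hδK⟩, X, hX𝒳, hδ, ⟨C₀, hC₀X, hC₀, ?_⟩, ?_, hinter⟩
  · rintro β hβ
    exact hKo _ (hC₀K ▸ hβ)
  · intro C hCX hC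
    obtain ⟨β, hβδ, hβ⟩ := hacc C hCX hC
    exact ⟨⟨β, hβδ⟩, hβ⟩

end SplittingGame

open SplittingGame in
theorem mainTheorem6 (h : SplittingGame.CPlus.{u}) :
    SplittingGame.SplitterHasWinningStrategy.{u} := by
  classical
  obtain ⟨𝒳, h𝒳, -, hcomp⟩ := h
  -- Splitter answers with `A` exactly when some set in `𝒳` is evidence that `A` has been avoided.
  let σ : SplitterStrategy.{u} := fun δ p =>
    if ∃ X ∈ 𝒳, omega1Part X = Set.Iio δ ∧ IsEvidence p .inA X then .A else .B
  refine ⟨σ, fun r hr => or_iff_not_imp_left.2 fun hE => ?_⟩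
  rw [not_not] at hE
  constructor
  · by_contra hA
    obtain ⟨K, hK, hdisj⟩ := not_isStationary_iff.1 hA
    obtain ⟨δ, ⟨hδE, hδK⟩, X, hX, hXδ, hev⟩ :=
      exists_isEvidence h𝒳 hE (o := .inA) hK fun α hα h => hdisj.notMem_of_mem_right hα h
    refine hdisj.notMem_of_mem_right hδK ((hr δ hδE).trans ?_)
    simp only [σ]
    rw [if_pos ⟨X, hX, hXδ, hev⟩]
    rfl
  · by_contra hB
    obtain ⟨K, hK, hdisj⟩ := not_isStationary_iff.1 hB
    obtain ⟨δ, ⟨hδE, hδK⟩, Y, hY, hYδ, hev⟩ :=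
      exists_isEvidence h𝒳 hE (o := .inB) hK fun α hα h => hdisj.notMem_of_mem_right hα h
    refine hdisj.notMem_of_mem_right hδK ((hr δ hδE).trans ?_)
    simp only [σ]
    rw [if_neg ?_]
    · rfl
    rintro ⟨X, hX, hXδ, hev'⟩
    -- Both sides cannot have been avoided: the clubs of one set refine those of the other.
    rcases hcomp X hX Y hY (hXδ.trans hYδ.symm) with hle | hle
    · refine hev'.not_of_refines hev (by rintro (_ | _ | _) <;> simp) fun C hCX hC => ?_
      obtain ⟨D, hDY, hD, hsub⟩ := hle C hCX hC
      exact ⟨D, hDY, hD, trace_inter_Iio_subset hXδ hsub⟩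
    · refine hev.not_of_refines hev' (by rintro (_ | _ | _) <;> simp) fun D hDY hD => ?_
      obtain ⟨C, hCX, hC, hsub⟩ := hle D hDY hD
      exact ⟨C, hCX, hC, trace_inter_Iio_subset hXδ hsub⟩
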